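/- For $z,\zeta\in\mathbb C$ with $z\neq0$ let $$\mathcal C(z,\zeta)=\int_0^{\pi/2}\cos\theta\,\sin^2\theta\,\cos(z\cos\theta)\,\cos(\zeta\cos^2\theta)\,d\theta ,$$ and let $\mathbf H_n(z)=\sum_{m\ge0}\frac{(-1)^m(z/2)^{2m+n+1}}{\Gamma(m+3/2)\,\Gamma(m+n+3/2)}$ ($n=0,1$) be the Struve functions. Then $$\mathcal C(z,\zeta)=\frac{\pi}{2}\sum_{\kappa=0}^{\infty}\frac{(-1)^{\kappa+1}\zeta^{2\kappa}}{(2\kappa)!}\Big[\mathbf H_0(z)\,\sigma_0(4\kappa+1,z)\Big(\frac2z\Big)^{4\kappa+1}+\mathbf H_1(z)\,\sigma_1(4\kappa+1,z)\Big(\frac2z\Big)^{4\kappa+2}+\sigma_2(4\kappa+1,z)\Big(\frac2z\Big)^{4\kappa}\Big],$$ where the series converges absolutely and the polynomials $\sigma_i(4\kappa+1,z)$ in $z$ are $$\sigma_0(4\kappa+1,z)=(4\kappa+1)!\sum_{\nu=0}^{2\kappa}\Big(\frac12\sum_{i=0}^{a_\nu}\frac{(-1/4)^i}{i!\,(4\kappa+1-2i)!}\,\frac{(4\kappa+1-\nu-i)!\,(4\kappa-\nu-i)!}{(4\kappa-2\nu-i)!}\Big)\frac{(-1)^{\nu+1}}{\nu!\,(\nu+1)!}\Big(\frac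 z2\Big)^{2\nu},$$ with $a_\nu=2\kappa+1$ for $\nu\le\kappa$ and $a_\nu=4\kappa+1-2\nu$ for $\nu>\kappa$; $$\sigma_1(4\kappa+1,z)=(4\kappa+1)!\sum_{\nu=0}^{2\kappa}\Big(\frac12\sum_{i=0}^{b_\nu}\frac{(-1/4)^i}{i!\,(4\kappa+1-2i)!}\,\frac{(4\kappa+1-\nu-i)!^2}{(4\kappa+1-2\nu-i)!}\Big)\frac{(-1)^{\nu}}{(\nu!)^2}\Big(\frac z2\Big)^{2\nu},$$ with $b_\nu=2\kappa+1$ for $\nu\le\kappa$ and $b_\nu=4\kappa+2-2\nu$ for $\nu>\kappa$; $$\sigma_2(4\kappa+1,z)=\frac{(4\kappa+1)!}{2\pi}\Big[\sum_{\nu=1}^{\kappa}\frac{\mathfrak C(4\kappa+1,2\kappa+1,\nu)}{\nu!}\Big(\frac z2\Big)^{2\nu-2}+\sum_{\nu=\kappa+1}^{2\kappa}\Big\{\frac{\mathfrak C(4\kappa+1,4\kappa+2-2\nu,\nu)}{\nu!}+\sum_{i=4\kappa+3-2\nu}^{2\kappa}\frac{(-1/4)^i}{i!\,(4\kappa+1-2i)!}\,\frac{\Gamma(4\kappa+3/2-\nu-i)}{\Gamma(\nu+3/2)}\Big\}\Big(\frac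 z2\Big)^{2\nu-2}\Big],$$ with $$\mathfrak C(k,a,\nu)=\sum_{j=0}^{a}\frac{(-1/4)^j}{j!}\,\frac{(k-\nu-j)!}{(k-2j)!}\sum_{i=0}^{\nu-1}\frac{(-1)^i}{i!}\,\frac{\sqrt\pi\,(k-j-i)!}{(k-\nu-j-i)!\;\Gamma(\nu+3/2-i)} .$$ Empty sums are zero, and every term with the factorial of a negative integer in a denominator is counted as zero. -/

import Mathlib

noncomputable section

namespace StruveIntegral

/-- The Struve function of natural-number order `n`,
`H_n(z) = ∑_m (-1)^m (z/2)^(2m+n+1) / (Γ(m+3/2) Γ(m+n+3/2))`, an entire function of `z`. -/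
def struveH (n : ℕ) (z : ℂ) : ℂ :=
  ∑' m : ℕ, (-1) ^ m * (z / 2) ^ (2 * m + n + 1) /
    (Complex.Gamma ((m : ℂ) + 3 / 2) * Complex.Gamma ((m : ℂ) + n + 3 / 2))

/-- The integral `∫_0^{π/2} cos θ sin² θ cos(z cos θ) cos(ζ cos² θ) dθ`. -/
def cosineIntegral (z ζ : ℂ) : ℂ :=
  ∫ θ in (0 : ℝ)..(Real.pi / 2),
    (Real.cos θ : ℂ) * (Real.sin θ : ℂ) ^ 2 * Complex.cos (z * (Real.cos θ : ℂ)) *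
      Complex.cos (ζ * (Real.cos θ : ℂ) ^ 2)

/-- The factorial of an integer. It is `0` at negative integers, so that (division by zero being
zero) a term with the factorial of a negative integer in its denominator is counted as zero,
which is the convention `1 / n! = 1 / Γ(n+1) = 0` for `n < 0`. -/
def intFact (n : ℤ) : ℂ :=
  if n < 0 then 0 else (Nat.factorial n.toNat : ℂ)

/-- The coefficients `ℭ(k, a, ν)`. -/
def coeffC (k a ν : ℕ) : ℂ :=
  ∑ j ∈ Finset.Icc 0 a,
    (-1 / 4) ^ j / intFact j * (intFact ((k : ℤ) - ν - j) / intFact ((k : ℤ) - 2 * j)) *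
      ∑ i ∈ Finset.range ν,
        (-1) ^ i / intFact i *
          ((Real.sqrt Real.pi : ℂ) * intFact ((k : ℤ) - j - i) /
            (intFact ((k : ℤ) - ν - j - i) * Complex.Gamma ((ν : ℂ) + 3 / 2 - i)))

/-- The polynomial `σ₀(4κ+1, z)`. -/
def sigma0 (κ : ℕ) (z : ℂ) : ℂ :=
  intFact (4 * κ + 1) *
    ((∑ ν ∈ Finset.Icc 0 κ,
        (1 / 2 * ∑ i ∈ Finset.Icc 0 (2 * κ + 1),
          (-1 / 4) ^ i / (intFact i * intFact (4 * (κ : ℤ) + 1 - 2 * i)) *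
            (intFact (4 * (κ : ℤ) + 1 - ν - i) * intFact (4 * (κ : ℤ) - ν - i) /
              intFact (4 * (κ : ℤ) - 2 * ν - i))) *
          ((-1) ^ (ν + 1) / (intFact ν * intFact (ν + 1))) * (z / 2) ^ (2 * ν)) +
      ∑ ν ∈ Finset.Icc (κ + 1) (2 * κ),
        (1 / 2 * ∑ i ∈ Finset.Icc 0 (4 * κ + 1 - 2 * ν),
          (-1 / 4) ^ i / (intFact i * intFact (4 * (κ : ℤ) + 1 - 2 * i)) *
            (intFact (4 * (κ : ℤ) + 1 - ν - i) * intFact (4 * (κ : ℤ) - ν - i) /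
              intFact (4 * (κ : ℤ) - 2 * ν - i))) *
          ((-1) ^ (ν + 1) / (intFact ν * intFact (ν + 1))) * (z / 2) ^ (2 * ν))

/-- The polynomial `σ₁(4κ+1, z)`. -/
def sigma1 (κ : ℕ) (z : ℂ) : ℂ :=
  intFact (4 * κ + 1) *
    ((∑ ν ∈ Finset.Icc 0 κ,
        (1 / 2 * ∑ i ∈ Finset.Icc 0 (2 * κ + 1),
          (-1 / 4) ^ i / (intFact i * intFact (4 * (κ : ℤ) + 1 - 2 * i)) *
            (intFact (4 * (κ : ℤ) + 1 - ν - i) ^ 2 /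
              intFact (4 * (κ : ℤ) + 1 - 2 * ν - i))) *
          ((-1) ^ ν / intFact ν ^ 2) * (z / 2) ^ (2 * ν)) +
      ∑ ν ∈ Finset.Icc (κ + 1) (2 * κ),
        (1 / 2 * ∑ i ∈ Finset.Icc 0 (4 * κ + 2 - 2 * ν),
          (-1 / 4) ^ i / (intFact i * intFact (4 * (κ : ℤ) + 1 - 2 * i)) *
            (intFact (4 * (κ : ℤ) + 1 - ν - i) ^ 2 /
              intFact (4 * (κ : ℤ) + 1 - 2 * ν - i))) *
          ((-1) ^ ν / intFact ν ^ 2) * (z / 2) ^ (2 * ν))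

/-- The polynomial `σ₂(4κ+1, z)`. In every exponent `2ν-2` below, `ν ≥ 1`. -/
def sigma2 (κ : ℕ) (z : ℂ) : ℂ :=
  intFact (4 * κ + 1) / (2 * (Real.pi : ℂ)) *
    ((∑ ν ∈ Finset.Icc 1 κ,
        coeffC (4 * κ + 1) (2 * κ + 1) ν / intFact ν * (z / 2) ^ (2 * ν - 2)) +
      ∑ ν ∈ Finset.Icc (κ + 1) (2 * κ),
        (coeffC (4 * κ + 1) (4 * κ + 2 - 2 * ν) ν / intFact ν +
          ∑ i ∈ Finset.Icc (4 * κ + 3 - 2 * ν) (2 * κ),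
            (-1 / 4) ^ i / (intFact i * intFact (4 * (κ : ℤ) + 1 - 2 * i)) *
              (Complex.Gamma (4 * (κ : ℂ) + 3 / 2 - ν - i) /
                Complex.Gamma ((ν : ℂ) + 3 / 2))) *
          (z / 2) ^ (2 * ν - 2))

/-- The `κ`-th term of the series, without the overall factor `π/2`. -/
def seriesTerm (z ζ : ℂ) (κ : ℕ) : ℂ :=
  (-1) ^ (κ + 1) * ζ ^ (2 * κ) / intFact (2 * κ) *
    (struveH 0 z * sigma0 κ z * (2 / z) ^ (4 * κ + 1) +
      struveH 1 z * sigma1 κ z * (2 / z) ^ (4 * κ + 2) +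
      sigma2 κ z * (2 / z) ^ (4 * κ))

end StruveIntegral

end

/-!
The integral is expanded twice. The cosine series in `ζ` reduces the theorem to the moments
`∫ cos^k θ sin² θ cos(z cos θ)` with `k = 4κ + 1`, each of which is shown to be `-π/2` times the
bracket in the `κ`-th term; the cosine series in `z` and Wallis integrals give the power series of
a moment.

Conceptually the moment is `(π/2) (d/dz)^k (H_1(z)/z)`. Writing
`(d/dz)^k = ∑_j k! / (2^j j! (k-2j)!) z^{k-2j} (z⁻¹ d/dz)^{k-j}` (`sum_hermiteCoeff`) leads to the
functions `(z⁻¹ d/dz)^n (H_1(z)/z)` with `n = k - j`, which are Struve functions of order `n + 1` up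
to elementary terms, and these reduce to `H_0` and `H_1` by means of Lommel polynomials. The inner
sums of `σ₀` and `σ₁` are exactly the coefficients of these polynomials.

The proof compares coefficients of powers of `(z/2)²`. For fixed `n`, let `reducedCoeff n N` be the
`N`-th coefficient of the Lommel combination of `H_0` and `H_1`. The recurrence of the Lommel
polynomials gives
`reducedCoeff (n+2) (N+1) = (n+2) reducedCoeff (n+1) (N+1) - reducedCoeff n N`, and two explicit
expressions satisfy the same recurrence:

* a quotient of Gamma values, the coefficient of `(z⁻¹ d/dz)^n (H_1(z)/z)`, which gives
  `reducedCoeff n N` for `n ≤ 2N + 1` (`reducedCoeff_eq_derivCoeff`);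
* the finite sum appearing in `ℭ`, which gives `reducedCoeff n N` for `n ≥ N + 1`
  (`reducedCoeff_eq_polarCoeff`).

For `N < 2κ` these two forms are what `σ₂` is made of, so `σ₂` cancels all negative powers of `z` in
the bracket (`sigma2_eq`). For `N ≥ 2κ` only the first form occurs, since `k ≤ 2N + 1`; the sum over
`j` is then a falling factorial, and the coefficient agrees with that of the moment
(`struveCoeff_add`).
-/

noncomputable section

namespace StruveIntegral

/-! ### Integer factorials and Lommel coefficients -/

lemma intFact_natCast (n : ℕ) : intFact (n : ℤ) = (n.factorial : ℂ) := by
  simp [intFact]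

lemma intFact_of_neg {m : ℤ} (h : m < 0) : intFact m = 0 := by
  simp [intFact, h]

lemma intFact_of_eq {m : ℤ} {n : ℕ} (h : m = n) : intFact m = (n.factorial : ℂ) := by
  rw [h, intFact_natCast]

/-- The recursion `1 / m! = (m + 1) / (m + 1)!`, valid at every integer since `1 / m!` is read as
zero for `m < 0`. -/
lemma inv_intFact (m : ℤ) : (intFact m)⁻¹ = (m + 1) * (intFact (m + 1))⁻¹ := by
  rcases lt_or_ge m 0 with h | h
  · rw [intFact_of_neg h]
    rcases eq_or_ne m (-1) with rfl | h'
    · simp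
    · rw [intFact_of_neg (by omega)]; simp
  · lift m to ℕ using h
    rw [intFact_natCast, intFact_of_eq (n := m + 1) (by push_cast; ring), Nat.factorial_succ]
    have h1 : (m : ℂ) + 1 ≠ 0 := Nat.cast_add_one_ne_zero m
    have h2 : (m.factorial : ℂ) ≠ 0 := Nat.cast_ne_zero.mpr m.factorial_ne_zero
    push_cast
    field_simp

/-- The coefficient with which `z^{2μ}` multiplies `H_0` when a Struve function of order `n + 1`
is lowered to the orders `0` and `1`; up to normalization, a coefficient of the Lommel
polynomial `R_{n-1,2}`. -/
def lommelZero (n μ : ℕ) : ℂ :=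
  intFact ((n : ℤ) - μ) * intFact ((n : ℤ) - 1 - μ) / intFact ((n : ℤ) - 1 - 2 * μ) *
    ((-1) ^ (μ + 1) / (intFact μ * intFact (μ + 1)))

/-- The coefficient with which `z^{2μ}` multiplies `H_1` when a Struve function of order `n + 1`
is lowered to the orders `0` and `1`; up to normalization, a coefficient of the Lommel
polynomial `R_{n,1}`. -/
def lommelOne (n μ : ℕ) : ℂ :=
  intFact ((n : ℤ) - μ) ^ 2 / intFact ((n : ℤ) - 2 * μ) * ((-1) ^ μ / intFact μ ^ 2)

lemma lommelZero_eq_zero {n μ : ℕ} (h : n < 2 * μ + 1) : lommelZero n μ = 0 := by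
  rw [lommelZero, intFact_of_neg (m := (n : ℤ) - 1 - 2 * μ) (by omega)]; simp

lemma lommelOne_eq_zero {n μ : ℕ} (h : n < 2 * μ) : lommelOne n μ = 0 := by
  rw [lommelOne, intFact_of_neg (m := (n : ℤ) - 2 * μ) (by omega)]; simp

lemma lommelZero_rec (n μ : ℕ) :
    lommelZero (n + 2) (μ + 1) = (n + 2) * lommelZero (n + 1) (μ + 1) - lommelZero n μ := by
  rcases lt_or_ge n (2 * μ + 1) with h | h
  · rw [lommelZero_eq_zero (by omega), lommelZero_eq_zero (by omega), lommelZero_eq_zero h]; simp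
  · obtain ⟨d, rfl⟩ := Nat.exists_eq_add_of_le h
    have e := inv_intFact ((d : ℤ) - 1)
    rw [sub_add_cancel, intFact_natCast] at e
    push_cast at e
    unfold lommelZero
    rw [intFact_of_eq (m := ((2 * μ + 1 + d + 2 : ℕ) : ℤ) - (μ + 1 : ℕ)) (n := μ + d + 2)
        (by push_cast; ring),
      intFact_of_eq (m := ((2 * μ + 1 + d + 2 : ℕ) : ℤ) - 1 - (μ + 1 : ℕ)) (n := μ + d + 1)
        (by push_cast; ring),
      intFact_of_eq (m := ((2 * μ + 1 + d + 2 : ℕ) : ℤ) - 1 - 2 * (μ + 1 : ℕ)) (n := d)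
        (by push_cast; ring),
      intFact_of_eq (m := ((2 * μ + 1 + d + 1 : ℕ) : ℤ) - (μ + 1 : ℕ)) (n := μ + d + 1)
        (by push_cast; ring),
      intFact_of_eq (m := ((2 * μ + 1 + d + 1 : ℕ) : ℤ) - 1 - (μ + 1 : ℕ)) (n := μ + d)
        (by push_cast; ring),
      show ((2 * μ + 1 + d + 1 : ℕ) : ℤ) - 1 - 2 * (μ + 1 : ℕ) = (d : ℤ) - 1 by push_cast; ring,
      intFact_of_eq (m := ((2 * μ + 1 + d : ℕ) : ℤ) - μ) (n := μ + d + 1)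
        (by push_cast; ring),
      intFact_of_eq (m := ((2 * μ + 1 + d : ℕ) : ℤ) - 1 - μ) (n := μ + d)
        (by push_cast; ring),
      intFact_of_eq (m := ((2 * μ + 1 + d : ℕ) : ℤ) - 1 - 2 * μ) (n := d)
        (by push_cast; ring),
      intFact_of_eq (m := ((μ + 1 : ℕ) : ℤ) + 1) (n := μ + 2) (by push_cast; ring),
      intFact_natCast, intFact_natCast,
      intFact_of_eq (m := (μ : ℤ) + 1) (n := μ + 1) (by push_cast; ring)]
    rw [div_eq_mul_inv _ (intFact _), e]
    have h1 : (μ : ℂ) + 1 ≠ 0 := Nat.cast_add_one_ne_zero μ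
    have h2 : (μ : ℂ) + 1 + 1 ≠ 0 := by exact_mod_cast Nat.cast_add_one_ne_zero (R := ℂ) (μ + 1)
    have h3 : (μ.factorial : ℂ) ≠ 0 := Nat.cast_ne_zero.mpr μ.factorial_ne_zero
    have h4 : (d.factorial : ℂ) ≠ 0 := Nat.cast_ne_zero.mpr d.factorial_ne_zero
    simp only [Nat.factorial_succ]
    push_cast
    field_simp
    ring

lemma lommelOne_rec (n μ : ℕ) :
    lommelOne (n + 2) (μ + 1) = (n + 2) * lommelOne (n + 1) (μ + 1) - lommelOne n μ := by
  rcases lt_or_ge n (2 * μ) with h | h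
  · rw [lommelOne_eq_zero (by omega), lommelOne_eq_zero (by omega), lommelOne_eq_zero h]; simp
  · obtain ⟨d, rfl⟩ := Nat.exists_eq_add_of_le h
    have e := inv_intFact ((d : ℤ) - 1)
    rw [sub_add_cancel, intFact_natCast] at e
    push_cast at e
    unfold lommelOne
    rw [intFact_of_eq (m := ((2 * μ + d + 2 : ℕ) : ℤ) - (μ + 1 : ℕ)) (n := μ + d + 1)
        (by push_cast; ring),
      intFact_of_eq (m := ((2 * μ + d + 2 : ℕ) : ℤ) - 2 * (μ + 1 : ℕ)) (n := d)
        (by push_cast; ring),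
      intFact_of_eq (m := ((2 * μ + d + 1 : ℕ) : ℤ) - (μ + 1 : ℕ)) (n := μ + d)
        (by push_cast; ring),
      show ((2 * μ + d + 1 : ℕ) : ℤ) - 2 * (μ + 1 : ℕ) = (d : ℤ) - 1 by push_cast; ring,
      intFact_of_eq (m := ((2 * μ + d : ℕ) : ℤ) - μ) (n := μ + d)
        (by push_cast; ring),
      intFact_of_eq (m := ((2 * μ + d : ℕ) : ℤ) - 2 * μ) (n := d)
        (by push_cast; ring),
      intFact_natCast, intFact_natCast]
    rw [div_eq_mul_inv _ (intFact _), e]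
    have h1 : (μ : ℂ) + 1 ≠ 0 := Nat.cast_add_one_ne_zero μ
    have h3 : (μ.factorial : ℂ) ≠ 0 := Nat.cast_ne_zero.mpr μ.factorial_ne_zero
    have h4 : (d.factorial : ℂ) ≠ 0 := Nat.cast_ne_zero.mpr d.factorial_ne_zero
    simp only [Nat.factorial_succ]
    push_cast
    field_simp
    ring

lemma lommelOne_zero_right (n : ℕ) : lommelOne n 0 = n.factorial := by
  have h4 : (n.factorial : ℂ) ≠ 0 := Nat.cast_ne_zero.mpr n.factorial_ne_zero
  simp only [lommelOne, Nat.cast_zero, mul_zero, sub_zero, intFact_natCast, pow_zero]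
  simp [intFact, pow_two, h4]

lemma lommelZero_succ_zero (n : ℕ) : lommelZero (n + 1) 0 = -((n + 1).factorial : ℂ) := by
  have h4 : (n.factorial : ℂ) ≠ 0 := Nat.cast_ne_zero.mpr n.factorial_ne_zero
  simp only [lommelZero, Nat.cast_zero, mul_zero, sub_zero, intFact_natCast]
  rw [intFact_of_eq (m := ((n + 1 : ℕ) : ℤ) - 1) (n := n) (by push_cast; ring)]
  simp [intFact, h4]

/-! ### Coefficients of the reduced Struve functions -/

/-- The coefficients of `H_0(z) / (z/2)` as a power series in `(z/2)²`. -/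
def struveCoeffZero (m : ℕ) : ℂ :=
  (-1) ^ m * ((Complex.Gamma ((m : ℂ) + 3 / 2))⁻¹ * (Complex.Gamma ((m : ℂ) + 3 / 2))⁻¹)

/-- The coefficients of `H_1(z) / (z/2)²` as a power series in `(z/2)²`. -/
def struveCoeffOne (m : ℕ) : ℂ :=
  (-1) ^ m * ((Complex.Gamma ((m : ℂ) + 3 / 2))⁻¹ * (Complex.Gamma ((m : ℂ) + 5 / 2))⁻¹)

/-- The `N`-th coefficient, as a power series in `(z/2)²`, of the combination of `H_0 / (z/2)` and
`H_1 / (z/2)²` whose polynomial coefficients are the Lommel coefficients of index `n`. -/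
def reducedCoeff (n N : ℕ) : ℂ :=
  ∑ p ∈ Finset.HasAntidiagonal.antidiagonal N,
    (lommelZero n p.1 * struveCoeffZero p.2 + lommelOne n p.1 * struveCoeffOne p.2)

lemma reducedCoeff_zero_right (n : ℕ) : reducedCoeff (n + 1) 0 =
    (n + 1).factorial * (struveCoeffOne 0 - struveCoeffZero 0) := by
  simp [reducedCoeff, lommelZero_succ_zero, lommelOne_zero_right]; ring

/-- The three-term recurrence that the combinations inherit from the Lommel polynomials. -/
lemma reducedCoeff_rec (n N : ℕ) : reducedCoeff (n + 2) (N + 1) =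
    (n + 2) * reducedCoeff (n + 1) (N + 1) - reducedCoeff n N := by
  simp only [reducedCoeff, Finset.Nat.sum_antidiagonal_succ, lommelZero_rec, lommelOne_rec,
    lommelZero_succ_zero, lommelOne_zero_right, mul_add, Finset.mul_sum]
  rw [add_sub_assoc, ← Finset.sum_sub_distrib]
  congr 1
  · rw [Nat.factorial_succ (n + 1)]; push_cast; ring
  · refine Finset.sum_congr rfl fun p _ => ?_
    ring

lemma lommelZero_zero (μ : ℕ) : lommelZero 0 μ = 0 := lommelZero_eq_zero (by omega)

lemma inv_Gamma (s : ℂ) : (Complex.Gamma s)⁻¹ = s * (Complex.Gamma (s + 1))⁻¹ :=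
  Complex.one_div_Gamma_eq_self_mul_one_div_Gamma_add_one s

/-- Up to a constant, the coefficient of `z^{2N+1}` in `H_1(z)/z` times the factor
`(2N+1)(2N-1)⋯(2N+3-2n)` that `n` applications of `z⁻¹ d/dz` produce. -/
def derivCoeff (n N : ℕ) : ℂ :=
  (-1) ^ (N + n) * ((Complex.Gamma ((N : ℂ) + 3 / 2 - n))⁻¹ * (Complex.Gamma ((N : ℂ) + 5 / 2))⁻¹)

lemma derivCoeff_rec (n N : ℕ) : derivCoeff (n + 2) (N + 1) =
    (n + 2) * derivCoeff (n + 1) (N + 1) - derivCoeff n N := by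
  unfold derivCoeff
  have h1 := inv_Gamma ((N : ℂ) + 1 / 2 - n)
  have h2 := inv_Gamma ((N : ℂ) + 5 / 2)
  push_cast
  rw [show (N : ℂ) + 1 + 3 / 2 - (n + 2) = (N : ℂ) + 1 / 2 - n by ring,
    show (N : ℂ) + 1 + 3 / 2 - (n + 1) = (N : ℂ) + 1 / 2 - n + 1 by ring,
    show (N : ℂ) + 3 / 2 - n = (N : ℂ) + 1 / 2 - n + 1 by ring,
    show (N : ℂ) + 1 + 5 / 2 = (N : ℂ) + 5 / 2 + 1 by ring, h1, h2]
  ring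

lemma reducedCoeff_zero_left (N : ℕ) : reducedCoeff 0 N = derivCoeff 0 N := by
  rw [reducedCoeff, Finset.sum_eq_single (0, N)]
  · simp [lommelZero_zero, lommelOne_zero_right, struveCoeffOne, derivCoeff]
  · rintro ⟨a, b⟩ h1 h2
    have : a ≠ 0 := by
      rintro rfl
      simp at h1
      exact h2 (by rw [h1])
    rw [lommelZero_zero, lommelOne_eq_zero (by simp; omega)]; simp
  · simp

lemma reducedCoeff_one_left (N : ℕ) : reducedCoeff 1 N = derivCoeff 1 N := by
  rw [reducedCoeff, Finset.sum_eq_single (0, N)]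
  · simp only [lommelZero_succ_zero 0, lommelOne_zero_right, struveCoeffOne, struveCoeffZero,
      derivCoeff]
    have h1 := inv_Gamma ((N : ℂ) + 1 / 2)
    have h2 := inv_Gamma ((N : ℂ) + 3 / 2)
    rw [show (N : ℂ) + 1 / 2 + 1 = (N : ℂ) + 3 / 2 by ring] at h1
    rw [show (N : ℂ) + 3 / 2 + 1 = (N : ℂ) + 5 / 2 by ring] at h2
    rw [show (N : ℂ) + 3 / 2 - (1 : ℕ) = (N : ℂ) + 1 / 2 by push_cast; ring, h1, h2]
    simp
    ring
  · rintro ⟨a, b⟩ h1 h2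
    have : a ≠ 0 := by
      rintro rfl
      simp at h1
      exact h2 (by rw [h1])
    rw [lommelZero_eq_zero (by simp; omega), lommelOne_eq_zero (by simp; omega)]; simp
  · simp

/-- For `n ≤ 2N + 1` the coefficient is the one of `(z⁻¹ d/dz)^n` applied to `H_1(z)/z`: both sides
satisfy the same three-term recurrence and agree for `n = 0, 1`. -/
lemma reducedCoeff_eq_derivCoeff (n : ℕ) :
    ∀ N : ℕ, n ≤ 2 * N + 1 → reducedCoeff n N = derivCoeff n N := by
  induction n using Nat.strong_induction_on with
  | _ n ih =>
    intro N hN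
    match n, N, ih, hN with
    | 0, N, _, _ => exact reducedCoeff_zero_left N
    | 1, N, _, _ => exact reducedCoeff_one_left N
    | n + 2, 0, _, hN => omega
    | n + 2, N + 1, ih, hN =>
      rw [reducedCoeff_rec, derivCoeff_rec, ih (n + 1) (by omega) _ (by omega),
        ih n (by omega) _ (by omega)]

/-- The closed form of the coefficient in the range `n ≥ N + 1`, up to the factor `-1/√π`. -/
def polarCoeff (n N : ℕ) : ℂ :=
  intFact ((n : ℤ) - 1 - N) / intFact (N + 1) *
    ∑ i ∈ Finset.range (N + 1), (-1) ^ i / intFact i *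
      (intFact ((n : ℤ) - i) /
        (intFact ((n : ℤ) - 1 - N - i) * Complex.Gamma ((N : ℂ) + 5 / 2 - i)))

lemma Gamma_half : Complex.Gamma (1 / 2) = (√Real.pi : ℂ) := by
  rw [Complex.Gamma_one_half_eq, Real.sqrt_eq_rpow, Complex.ofReal_cpow Real.pi_pos.le]
  norm_num

lemma derivCoeff_succ_self (N : ℕ) :
    derivCoeff (N + 1) N = -(√Real.pi : ℂ)⁻¹ * (Complex.Gamma ((N : ℂ) + 5 / 2))⁻¹ := by
  unfold derivCoeff
  rw [show (N : ℂ) + 3 / 2 - (N + 1 : ℕ) = 1 / 2 by push_cast; ring, Gamma_half,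
    show N + (N + 1) = 2 * N + 1 by ring, pow_succ, pow_mul]
  simp

lemma polarCoeff_succ_self (N : ℕ) :
    polarCoeff (N + 1) N = (Complex.Gamma ((N : ℂ) + 5 / 2))⁻¹ := by
  unfold polarCoeff
  rw [Finset.sum_eq_single 0]
  · rw [intFact_of_eq (m := ((N + 1 : ℕ) : ℤ) - 1 - N) (n := 0) (by push_cast; ring),
      intFact_of_eq (m := (N : ℤ) + 1) (n := N + 1) (by push_cast; ring),
      intFact_of_eq (m := ((N + 1 : ℕ) : ℤ) - (0 : ℕ)) (n := N + 1) (by push_cast; ring),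
      intFact_of_eq (m := ((N + 1 : ℕ) : ℤ) - 1 - N - (0 : ℕ)) (n := 0) (by push_cast; ring)]
    have h4 : ((N + 1).factorial : ℂ) ≠ 0 := Nat.cast_ne_zero.mpr (N + 1).factorial_ne_zero
    simp [intFact]
    field_simp
  · intro i _ hi
    rw [intFact_of_neg (m := ((N + 1 : ℕ) : ℤ) - 1 - N - i) (by omega)]; simp
  · simp

lemma polarCoeff_zero_right (n : ℕ) :
    polarCoeff (n + 1) 0 = (n + 1).factorial * (Complex.Gamma (5 / 2))⁻¹ := by
  have h4 : (n.factorial : ℂ) ≠ 0 := Nat.cast_ne_zero.mpr n.factorial_ne_zero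
  have h0 : intFact (((n + 1 : ℕ) : ℤ) - 1) = n.factorial := intFact_of_eq (by push_cast; ring)
  simp only [polarCoeff, zero_add, Finset.sum_range_one, Nat.cast_zero, sub_zero, h0,
    intFact_natCast]
  simp [intFact]
  field_simp

/-- The closed form satisfies the same recurrence; after a shift of the summation index by one in
the last sum, it holds summand by summand. -/
lemma polarCoeff_rec (n N : ℕ) (h : N < n) : polarCoeff (n + 2) (N + 1) =
    (n + 2) * polarCoeff (n + 1) (N + 1) - polarCoeff n N := by
  obtain ⟨d, rfl⟩ := Nat.exists_eq_add_of_lt h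
  have hN : (N : ℂ) + 1 ≠ 0 := Nat.cast_add_one_ne_zero N
  have hN2 : (N : ℂ) + 1 + 1 ≠ 0 := by exact_mod_cast Nat.cast_add_one_ne_zero (R := ℂ) (N + 1)
  have hNf : (N.factorial : ℂ) ≠ 0 := Nat.cast_ne_zero.mpr N.factorial_ne_zero
  unfold polarCoeff
  rw [Finset.sum_range_succ' _ (N + 1), Finset.sum_range_succ' _ (N + 1), mul_add, mul_add, mul_add,
    Finset.mul_sum, Finset.mul_sum, Finset.mul_sum, Finset.mul_sum]
  rw [intFact_of_eq (m := ((N + d + 1 + 2 : ℕ) : ℤ) - 1 - (N + 1 : ℕ)) (n := d + 1)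
      (by push_cast; ring),
    intFact_of_eq (m := ((N + d + 1 + 1 : ℕ) : ℤ) - 1 - (N + 1 : ℕ)) (n := d)
      (by push_cast; ring),
    intFact_of_eq (m := ((N + d + 1 : ℕ) : ℤ) - 1 - N) (n := d) (by push_cast; ring),
    intFact_of_eq (m := ((N + 1 : ℕ) : ℤ) + 1) (n := N + 2) (by push_cast; ring),
    intFact_of_eq (m := (N : ℤ) + 1) (n := N + 1) (by push_cast; ring)]
  have hd : (d : ℂ) + 1 ≠ 0 := Nat.cast_add_one_ne_zero d
  have hdf : (d.factorial : ℂ) ≠ 0 := Nat.cast_ne_zero.mpr d.factorial_ne_zero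
  refine (congrArg₂ (· + ·) ?_ ?_).trans (add_sub_right_comm _ _ _).symm
  · rw [← Finset.sum_sub_distrib]
    refine Finset.sum_congr rfl fun i hi => ?_
    have hi' : i ≤ N := by simpa [Nat.lt_succ_iff] using hi
    have hif : (i.factorial : ℂ) ≠ 0 := Nat.cast_ne_zero.mpr i.factorial_ne_zero
    have hi1 : (i : ℂ) + 1 ≠ 0 := Nat.cast_add_one_ne_zero i
    obtain ⟨c, rfl⟩ := Nat.exists_eq_add_of_le hi'
    rw [show ((i + c + 1 : ℕ) : ℂ) + 5 / 2 - (i + 1 : ℕ) = ((i + c : ℕ) : ℂ) + 5 / 2 - i by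
        push_cast; ring,
      intFact_of_eq (m := ((i + c + d + 1 + 2 : ℕ) : ℤ) - (i + 1 : ℕ)) (n := c + d + 2)
        (by push_cast; ring),
      intFact_of_eq (m := ((i + c + d + 1 + 1 : ℕ) : ℤ) - (i + 1 : ℕ)) (n := c + d + 1)
        (by push_cast; ring),
      intFact_of_eq (m := ((i + c + d + 1 : ℕ) : ℤ) - i) (n := c + d + 1)
        (by push_cast; ring),
      show ((i + c + d + 1 + 2 : ℕ) : ℤ) - 1 - (i + c + 1 : ℕ) - (i + 1 : ℕ) = d - i by
        push_cast; ring,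
      show ((i + c + d + 1 + 1 : ℕ) : ℤ) - 1 - (i + c + 1 : ℕ) - (i + 1 : ℕ) = d - i - 1 by
        push_cast; ring,
      show ((i + c + d + 1 : ℕ) : ℤ) - 1 - (i + c : ℕ) - i = d - i by
        push_cast; ring, intFact_natCast, intFact_natCast]
    have e := inv_intFact ((d : ℤ) - i - 1)
    rw [sub_add_cancel] at e
    simp only [div_eq_mul_inv, mul_inv]
    rw [e]
    simp only [Nat.factorial_succ]
    push_cast at hN hN2 ⊢
    field_simp
    ring
  · rw [intFact_of_eq (m := ((N + d + 1 + 2 : ℕ) : ℤ) - (0 : ℕ)) (n := N + d + 3)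
        (by push_cast; ring),
      intFact_of_eq (m := ((N + d + 1 + 1 : ℕ) : ℤ) - (0 : ℕ)) (n := N + d + 2)
        (by push_cast; ring),
      intFact_of_eq (m := ((N + d + 1 + 2 : ℕ) : ℤ) - 1 - (N + 1 : ℕ) - (0 : ℕ)) (n := d + 1)
        (by push_cast; ring),
      intFact_of_eq (m := ((N + d + 1 + 1 : ℕ) : ℤ) - 1 - (N + 1 : ℕ) - (0 : ℕ)) (n := d)
        (by push_cast; ring)]
    simp only [Nat.factorial_succ, intFact_natCast]
    push_cast
    field_simp
    ring

/-- For `n ≥ N + 1` the coefficient is the finite sum `polarCoeff`, by induction on `n` from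
`n = N + 1`, where `reducedCoeff_eq_derivCoeff` applies. -/
lemma reducedCoeff_eq_polarCoeff (N d : ℕ) :
    reducedCoeff (N + d + 1) N = -(√Real.pi : ℂ)⁻¹ * polarCoeff (N + d + 1) N := by
  induction N generalizing d with
  | zero =>
    have h : struveCoeffOne 0 - struveCoeffZero 0 =
        -(√Real.pi : ℂ)⁻¹ * (Complex.Gamma (5 / 2))⁻¹ := by
      have h1 := inv_Gamma (1 / 2)
      have h2 := inv_Gamma (3 / 2)
      rw [Gamma_half, show (1 / 2 : ℂ) + 1 = 3 / 2 by norm_num] at h1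
      rw [show (3 / 2 : ℂ) + 1 = 5 / 2 by norm_num] at h2
      simp only [struveCoeffOne, struveCoeffZero, Nat.cast_zero, zero_add, h1, h2]
      ring
    rw [zero_add, reducedCoeff_zero_right, polarCoeff_zero_right, h]; ring
  | succ N ih =>
    induction d with
    | zero =>
      rw [add_zero, reducedCoeff_eq_derivCoeff _ _ (by omega), derivCoeff_succ_self,
        polarCoeff_succ_self]
    | succ d ihd =>
      have h1 := reducedCoeff_rec (N + d + 1) N
      have h2 := polarCoeff_rec (N + d + 1) N (by omega)
      rw [show N + 1 + (d + 1) + 1 = N + d + 1 + 2 by ring, h1, h2, ih,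
        show N + d + 1 + 1 = N + 1 + d + 1 by ring, ihd]
      ring

/-- Euler's reflection formula turns `derivCoeff` into a quotient of Gamma values. -/
lemma derivCoeff_eq_Gamma (n N : ℕ) : derivCoeff n N =
    -(Real.pi : ℂ)⁻¹ * (Complex.Gamma ((n : ℂ) - N - 1 / 2) / Complex.Gamma ((N : ℂ) + 5 / 2)) := by
  have h := Complex.Gamma_mul_Gamma_one_sub ((n : ℂ) - N - 1 / 2)
  have hs : Complex.sin (Real.pi * ((n : ℂ) - N - 1 / 2)) = -(-1) ^ (N + n) := by
    have e : (Real.pi : ℂ) * ((n : ℂ) - N - 1 / 2) = ((n : ℤ) - N : ℤ) * Real.pi - Real.pi / 2 := by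
      push_cast; ring
    rw [e, Complex.sin_sub_pi_div_two, ← Complex.ofReal_intCast, ← Complex.ofReal_mul,
      ← Complex.ofReal_cos, Real.cos_int_mul_pi, zpow_sub₀ (by norm_num), pow_add]
    rcases neg_one_pow_eq_or ℂ N with h | h <;> simp [h, div_neg]
  have hne : Complex.Gamma ((N : ℂ) + 3 / 2 - n) ≠ 0 := by
    apply Complex.Gamma_ne_zero
    intro m hm
    have : (((2 * N + 3 + 2 * m : ℕ) : ℤ) : ℂ) = ((2 * n : ℕ) : ℤ) := by
      push_cast; linear_combination 2 * hm
    have := Int.cast_injective this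
    omega
  have hpi : (Real.pi : ℂ) ≠ 0 := Complex.ofReal_ne_zero.mpr Real.pi_ne_zero
  rw [hs, show 1 - ((n : ℂ) - N - 1 / 2) = (N : ℂ) + 3 / 2 - n by ring] at h
  unfold derivCoeff
  have h' : Complex.Gamma ((n : ℂ) - N - 1 / 2) =
      -(-1) ^ (N + n) * Real.pi * (Complex.Gamma ((N : ℂ) + 3 / 2 - n))⁻¹ := by
    rw [eq_mul_inv_iff_mul_eq₀ hne, h]
    rcases neg_one_pow_eq_or ℂ (N + n) with h | h <;> simp [h, div_eq_mul_inv]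
  rw [h']
  field_simp

/-! ### Power series of the reduced Struve functions -/

lemma hasSum_of_eq {f g : ℕ → ℂ} {a : ℂ} (h : HasSum g a) (e : ∀ n, f n = g n) : HasSum f a := by
  rwa [funext e]

lemma norm_inv_Gamma_le (m : ℕ) : ‖(Complex.Gamma ((m : ℂ) + 3 / 2))⁻¹‖ ≤
    ‖(Complex.Gamma (3 / 2))⁻¹‖ / m.factorial := by
  induction m with
  | zero => simp
  | succ m ih =>
    have h := inv_Gamma ((m : ℂ) + 3 / 2)
    have h2 : ‖(m : ℂ) + 3 / 2‖ = m + 3 / 2 := by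
      rw [show (m : ℂ) + 3 / 2 = ((m + 3 / 2 : ℝ) : ℂ) by push_cast; ring, Complex.norm_real,
        Real.norm_of_nonneg (by positivity)]
    rw [h, norm_mul, h2] at ih
    rw [Nat.factorial_succ]
    push_cast
    rw [show (m : ℂ) + 1 + 3 / 2 = (m : ℂ) + 3 / 2 + 1 by ring, mul_comm ((m : ℝ) + 1),
      ← div_div, le_div_iff₀ (by positivity)]
    refine le_trans ?_ ih
    rw [mul_comm]
    gcongr
    norm_num

lemma norm_inv_Gamma_le' (m : ℕ) : ‖(Complex.Gamma ((m : ℂ) + 3 / 2))⁻¹‖ ≤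
    ‖(Complex.Gamma (3 / 2))⁻¹‖ :=
  (norm_inv_Gamma_le m).trans (div_le_self (norm_nonneg _)
    (by exact_mod_cast Nat.one_le_iff_ne_zero.mpr m.factorial_ne_zero))

lemma summable_struveCoeff_aux (x : ℂ) (u : ℕ → ℂ)
    (hu : ∀ m, ‖u m‖ ≤ ‖(Complex.Gamma (3 / 2))⁻¹‖) : Summable fun m : ℕ =>
      ‖(-1) ^ m * ((Complex.Gamma ((m : ℂ) + 3 / 2))⁻¹ * u m) * x ^ m‖ := by
  refine Summable.of_nonneg_of_le (fun _ => norm_nonneg _) (fun m => ?_)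
    ((Real.summable_pow_div_factorial ‖x‖).mul_left (‖(Complex.Gamma (3 / 2))⁻¹‖ ^ 2))
  rw [norm_mul, norm_mul, norm_mul, norm_pow, norm_pow, norm_neg, norm_one, one_pow, one_mul]
  calc _ ≤ ‖(Complex.Gamma (3 / 2))⁻¹‖ / m.factorial * ‖(Complex.Gamma (3 / 2))⁻¹‖ * ‖x‖ ^ m := by
        gcongr
        · exact norm_inv_Gamma_le m
        · exact hu m
    _ = _ := by ring

lemma summable_struveCoeffZero (x : ℂ) : Summable fun m => ‖struveCoeffZero m * x ^ m‖ :=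
  summable_struveCoeff_aux x _ norm_inv_Gamma_le'

lemma summable_struveCoeffOne (x : ℂ) : Summable fun m => ‖struveCoeffOne m * x ^ m‖ := by
  refine summable_struveCoeff_aux x _ fun m => ?_
  have := norm_inv_Gamma_le' (m + 1)
  rwa [show ((m + 1 : ℕ) : ℂ) + 3 / 2 = (m : ℂ) + 5 / 2 by push_cast; ring] at this

lemma struveH_zero (z : ℂ) :
    struveH 0 z = z / 2 * ∑' m, struveCoeffZero m * ((z / 2) ^ 2) ^ m := by
  rw [struveH, ← tsum_mul_left]
  refine tsum_congr fun m => ?_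
  rw [struveCoeffZero, Nat.cast_zero, add_zero, add_zero, pow_succ, pow_mul]
  generalize z / 2 = w
  simp only [div_eq_mul_inv _ (_ * _), mul_inv]
  ring

lemma struveH_one (z : ℂ) :
    struveH 1 z = (z / 2) ^ 2 * ∑' m, struveCoeffOne m * ((z / 2) ^ 2) ^ m := by
  rw [struveH, ← tsum_mul_left]
  refine tsum_congr fun m => ?_
  rw [struveCoeffOne, show (m : ℂ) + (1 : ℕ) + 3 / 2 = m + 5 / 2 by push_cast; ring,
    div_eq_mul_inv, mul_inv, add_assoc, pow_add, pow_mul]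
  ring

/-- The Cauchy product of a polynomial and a power series. -/
lemma hasSum_poly_mul (c h : ℕ → ℂ) (x : ℂ) (R : ℕ) (hc : ∀ μ, R ≤ μ → c μ = 0)
    (hh : Summable fun m => ‖h m * x ^ m‖) :
    HasSum (fun N => (∑ p ∈ Finset.HasAntidiagonal.antidiagonal N, c p.1 * h p.2) * x ^ N)
      ((∑ μ ∈ Finset.range R, c μ * x ^ μ) * ∑' m, h m * x ^ m) := by
  have h0 : ∀ μ ∉ Finset.range R, c μ * x ^ μ = 0 := fun μ hμ => by
    rw [hc μ (by simpa using hμ), zero_mul]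
  have hs : Summable fun μ => ‖c μ * x ^ μ‖ :=
    summable_of_ne_finset_zero (s := Finset.range R) fun μ hμ => by rw [h0 μ hμ, norm_zero]
  have key := tsum_mul_tsum_eq_tsum_sum_antidiagonal_of_summable_norm hs hh
  have key2 := (summable_norm_sum_mul_antidiagonal_of_summable_norm hs hh).of_norm
  rw [tsum_eq_sum h0] at key
  rw [key]
  refine hasSum_of_eq key2.hasSum fun N => ?_
  rw [Finset.sum_mul]
  refine Finset.sum_congr rfl fun p hp => ?_
  rw [← Finset.HasAntidiagonal.mem_antidiagonal.mp hp, pow_add]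
  ring

lemma hasSum_reducedCoeff (n R : ℕ) (hR : n < 2 * R) (x : ℂ) :
    HasSum (fun N => reducedCoeff n N * x ^ N)
      ((∑ μ ∈ Finset.range R, lommelZero n μ * x ^ μ) * (∑' m, struveCoeffZero m * x ^ m) +
        (∑ μ ∈ Finset.range R, lommelOne n μ * x ^ μ) * ∑' m, struveCoeffOne m * x ^ m) := by
  have h := (hasSum_poly_mul _ _ x R 
    (fun μ hμ => lommelZero_eq_zero (n := n) (μ := μ) (by omega))
    (summable_struveCoeffZero x)).add (hasSum_poly_mul _ _ x R
      (fun μ hμ => lommelOne_eq_zero (n := n) (μ := μ) (by omega)) (summable_struveCoeffOne x))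
  convert h using 2 with N
  rw [reducedCoeff, Finset.sum_add_distrib, add_mul]

/-! ### The polynomials `σ₀`, `σ₁`, `σ₂` in terms of reduced coefficients -/

/-- The weight `(-1/4)^j / (j! (k-2j)!)` for `k = 4κ + 1`. It is `(-1/2)^j` times the coefficient of
`z^{k-2j} (z⁻¹ d/dz)^{k-j}` in `(d/dz)^k / k!`; the power of `-1/2` comes from the signs of the
Lommel coefficients and from the expansion in powers of `z/2`. -/
def weight (κ j : ℕ) : ℂ :=
  (-1 / 4) ^ j / (intFact j * intFact (4 * (κ : ℤ) + 1 - 2 * j))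

lemma weight_eq_zero {κ j : ℕ} (h : 2 * κ < j) : weight κ j = 0 := by
  rw [weight, intFact_of_neg (m := 4 * (κ : ℤ) + 1 - 2 * j) (by omega)]; simp

lemma sum_eq_sum_of_eq_zero (s t : Finset ℕ) (f : ℕ → ℂ) (h1 : ∀ i ∈ s, i ∉ t → f i = 0)
    (h2 : ∀ i ∈ t, i ∉ s → f i = 0) : ∑ i ∈ s, f i = ∑ i ∈ t, f i := by
  rw [← Finset.sum_subset (Finset.inter_subset_left (s₁ := s) (s₂ := t))
    (fun i hi hi' => h1 i hi fun h => hi' (Finset.mem_inter.mpr ⟨hi, h⟩)),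
    Finset.sum_subset (Finset.inter_subset_right (s₁ := s) (s₂ := t))
    (fun i hi hi' => h2 i hi fun h => hi' (Finset.mem_inter.mpr ⟨h, hi⟩))]

lemma sum_Icc_add_sum_Icc (f : ℕ → ℂ) {a b c : ℕ} (hab : a ≤ b + 1) (hbc : b ≤ c) :
    ∑ i ∈ Finset.Icc a b, f i + ∑ i ∈ Finset.Icc (b + 1) c, f i = ∑ i ∈ Finset.Icc a c, f i := by
  have e : ∀ p q : ℕ, Finset.Icc p q = Finset.Ico p (q + 1) := fun p q => by ext; simp
  rw [e, e, e, Finset.sum_Ico_consecutive f hab (by omega)]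

lemma range_succ_eq_Icc (n : ℕ) : Finset.range (n + 1) = Finset.Icc 0 n := by
  ext; simp

lemma lommelZero_sub {κ j : ℕ} (h : j ≤ 2 * κ) (ν : ℕ) : lommelZero (4 * κ + 1 - j) ν =
    intFact (4 * (κ : ℤ) + 1 - ν - j) * intFact (4 * (κ : ℤ) - ν - j) /
      intFact (4 * (κ : ℤ) - 2 * ν - j) * ((-1) ^ (ν + 1) / (intFact ν * intFact (ν + 1))) := by
  rw [lommelZero, show ((4 * κ + 1 - j : ℕ) : ℤ) - ν = 4 * (κ : ℤ) + 1 - ν - j by omega,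
    show ((4 * κ + 1 - j : ℕ) : ℤ) - 1 - ν = 4 * (κ : ℤ) - ν - j by omega,
    show ((4 * κ + 1 - j : ℕ) : ℤ) - 1 - 2 * ν = 4 * (κ : ℤ) - 2 * ν - j by omega]

lemma lommelOne_sub {κ j : ℕ} (h : j ≤ 2 * κ) (ν : ℕ) : lommelOne (4 * κ + 1 - j) ν =
    intFact (4 * (κ : ℤ) + 1 - ν - j) ^ 2 / intFact (4 * (κ : ℤ) + 1 - 2 * ν - j) *
      ((-1) ^ ν / intFact ν ^ 2) := by
  rw [lommelOne, show ((4 * κ + 1 - j : ℕ) : ℤ) - ν = 4 * (κ : ℤ) + 1 - ν - j by omega,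
    show ((4 * κ + 1 - j : ℕ) : ℤ) - 2 * ν = 4 * (κ : ℤ) + 1 - 2 * ν - j by omega]

lemma sigma0_eq (κ : ℕ) (z : ℂ) : sigma0 κ z = (4 * κ + 1).factorial / 2 *
    ∑ j ∈ Finset.range (2 * κ + 1), weight κ j *
      ∑ ν ∈ Finset.range (2 * κ + 1), lommelZero (4 * κ + 1 - j) ν * ((z / 2) ^ 2) ^ ν := by
  have hf : intFact (4 * (κ : ℤ) + 1) = (4 * κ + 1).factorial := intFact_of_eq (by push_cast; ring)
  have key : ∀ ν : ℕ, ∀ B : ℕ, (2 * κ ≤ B ∨ 4 * κ + 1 - 2 * ν ≤ B ∧ 2 * ν ≤ 4 * κ) →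
      (1 / 2 * ∑ i ∈ Finset.Icc 0 B,
          (-1 / 4) ^ i / (intFact i * intFact (4 * (κ : ℤ) + 1 - 2 * i)) *
            (intFact (4 * (κ : ℤ) + 1 - ν - i) * intFact (4 * (κ : ℤ) - ν - i) /
              intFact (4 * (κ : ℤ) - 2 * ν - i))) *
          ((-1) ^ (ν + 1) / (intFact ν * intFact (ν + 1))) * (z / 2) ^ (2 * ν) =
      1 / 2 * ∑ j ∈ Finset.range (2 * κ + 1),
        weight κ j * (lommelZero (4 * κ + 1 - j) ν * ((z / 2) ^ 2) ^ ν) := by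
    intro ν B hB
    rw [sum_eq_sum_of_eq_zero (Finset.Icc 0 B) (Finset.range (2 * κ + 1)), mul_assoc, mul_assoc,
      Finset.sum_mul]
    · congr 1
      refine Finset.sum_congr rfl fun j hj => ?_
      rw [lommelZero_sub (by simp at hj; omega), weight, pow_mul]
      ring
    · intro i _ hi
      rw [intFact_of_neg (m := 4 * (κ : ℤ) + 1 - 2 * i) (by simp at hi; omega)]; simp
    · intro i hi hi'
      rw [intFact_of_neg (m := 4 * (κ : ℤ) - 2 * ν - i) (by simp at hi hi'; omega)]; simp
  rw [sigma0, hf,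
    Finset.sum_congr rfl fun ν hν => key ν (2 * κ + 1) (by simp at hν; omega),
    Finset.sum_congr rfl fun ν hν => key ν (4 * κ + 1 - 2 * ν) (by simp at hν; omega),
    sum_Icc_add_sum_Icc _ (by omega) (by omega), ← Finset.mul_sum, Finset.sum_comm,
    ← range_succ_eq_Icc]
  simp only [Finset.mul_sum]
  refine Finset.sum_congr rfl fun j _ => Finset.sum_congr rfl fun ν _ => ?_
  ring

lemma sigma1_eq (κ : ℕ) (z : ℂ) : sigma1 κ z = (4 * κ + 1).factorial / 2 *
    ∑ j ∈ Finset.range (2 * κ + 1), weight κ j *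
      ∑ ν ∈ Finset.range (2 * κ + 1), lommelOne (4 * κ + 1 - j) ν * ((z / 2) ^ 2) ^ ν := by
  have hf : intFact (4 * (κ : ℤ) + 1) = (4 * κ + 1).factorial := intFact_of_eq (by push_cast; ring)
  have key : ∀ ν : ℕ, ∀ B : ℕ, (2 * κ ≤ B ∨ 4 * κ + 1 - 2 * ν ≤ B ∧ 2 * ν ≤ 4 * κ) →
      (1 / 2 * ∑ i ∈ Finset.Icc 0 B,
          (-1 / 4) ^ i / (intFact i * intFact (4 * (κ : ℤ) + 1 - 2 * i)) *
            (intFact (4 * (κ : ℤ) + 1 - ν - i) ^ 2 /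
              intFact (4 * (κ : ℤ) + 1 - 2 * ν - i))) *
          ((-1) ^ ν / intFact ν ^ 2) * (z / 2) ^ (2 * ν) =
      1 / 2 * ∑ j ∈ Finset.range (2 * κ + 1),
        weight κ j * (lommelOne (4 * κ + 1 - j) ν * ((z / 2) ^ 2) ^ ν) := by
    intro ν B hB
    rw [sum_eq_sum_of_eq_zero (Finset.Icc 0 B) (Finset.range (2 * κ + 1)), mul_assoc, mul_assoc,
      Finset.sum_mul]
    · congr 1
      refine Finset.sum_congr rfl fun j hj => ?_
      rw [lommelOne_sub (by simp at hj; omega), weight, pow_mul]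
      ring
    · intro i _ hi
      rw [intFact_of_neg (m := 4 * (κ : ℤ) + 1 - 2 * i) (by simp at hi; omega)]; simp
    · intro i hi hi'
      rw [intFact_of_neg (m := 4 * (κ : ℤ) + 1 - 2 * ν - i) (by simp at hi hi'; omega)]; simp
  rw [sigma1, hf,
    Finset.sum_congr rfl fun ν hν => key ν (2 * κ + 1) (by simp at hν; omega),
    Finset.sum_congr rfl fun ν hν => key ν (4 * κ + 2 - 2 * ν) (by simp at hν; omega),
    sum_Icc_add_sum_Icc _ (by omega) (by omega), ← Finset.mul_sum, Finset.sum_comm,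
    ← range_succ_eq_Icc]
  simp only [Finset.mul_sum]
  refine Finset.sum_congr rfl fun j _ => Finset.sum_congr rfl fun ν _ => ?_
  ring

/-- The `N`-th coefficient, as a power series in `(z/2)²`, of the Struve part of the `κ`-th term,
up to normalization. -/
def struveCoeff (κ N : ℕ) : ℂ :=
  ∑ j ∈ Finset.range (2 * κ + 1), weight κ j * reducedCoeff (4 * κ + 1 - j) N

lemma coeffC_div (κ a N : ℕ) (ha : a ≤ 4 * κ + 1) :
    coeffC (4 * κ + 1) a (N + 1) / intFact ((N + 1 : ℕ) : ℤ) =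
      ∑ j ∈ Finset.Icc 0 a, weight κ j * ((√Real.pi : ℂ) * polarCoeff (4 * κ + 1 - j) N) := by
  rw [coeffC, Finset.sum_div]
  refine Finset.sum_congr rfl fun j hj => ?_
  have hj' : j ≤ 4 * κ + 1 := by simp at hj; omega
  have e1 : ((4 * κ + 1 - j : ℕ) : ℤ) = 4 * (κ : ℤ) + 1 - j := by omega
  rw [weight, polarCoeff, e1]
  simp only [Finset.mul_sum, Finset.sum_div]
  refine Finset.sum_congr rfl fun i _ => ?_
  push_cast
  rw [show (N : ℂ) + 1 + 3 / 2 - i = N + 5 / 2 - i by ring,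
    show 4 * (κ : ℤ) + 1 - j - 1 - N = 4 * (κ : ℤ) + 1 - (N + 1) - j by ring]
  simp only [div_eq_mul_inv, mul_inv]
  ring

lemma sqrt_pi_mul_polarCoeff (n N : ℕ) (h : N + 1 ≤ n) :
    (√Real.pi : ℂ) * polarCoeff n N = -Real.pi * reducedCoeff n N := by
  obtain ⟨d, rfl⟩ := Nat.exists_eq_add_of_le h
  have hpi : (√Real.pi : ℂ) ≠ 0 :=
    Complex.ofReal_ne_zero.mpr (Real.sqrt_ne_zero'.mpr Real.pi_pos)
  have h2 : (Real.pi : ℂ) = √Real.pi * √Real.pi := by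
    rw [← Complex.ofReal_mul, Real.mul_self_sqrt Real.pi_pos.le]
  rw [show N + 1 + d = N + d + 1 by ring, reducedCoeff_eq_polarCoeff, h2]
  field_simp

/-- The polynomial `σ₂` removes exactly the terms with a negative power of `z` from the Struve part. -/
lemma sigma2_eq (κ : ℕ) (z : ℂ) : sigma2 κ z = -((4 * κ + 1).factorial / 2 *
    ∑ N ∈ Finset.range (2 * κ), struveCoeff κ N * ((z / 2) ^ 2) ^ N) := by
  have hf : intFact (4 * (κ : ℤ) + 1) = (4 * κ + 1).factorial := intFact_of_eq (by push_cast; ring)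
  have hpi : (Real.pi : ℂ) ≠ 0 := Complex.ofReal_ne_zero.mpr Real.pi_ne_zero
  have h1 : ∀ ν ∈ Finset.Icc 1 κ,
      coeffC (4 * κ + 1) (2 * κ + 1) ν / intFact ν * (z / 2) ^ (2 * ν - 2) =
        -Real.pi * (struveCoeff κ (ν - 1) * ((z / 2) ^ 2) ^ (ν - 1)) := by
    intro ν hν
    obtain ⟨N, rfl⟩ : ∃ N, ν = N + 1 := ⟨ν - 1, by simp at hν; omega⟩
    have hN : N + 1 ≤ κ := by simp at hν; omega
    rw [coeffC_div _ _ _ (by omega), struveCoeff,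
      sum_eq_sum_of_eq_zero _ (Finset.range (2 * κ + 1)), ← pow_mul, ← mul_assoc, Finset.mul_sum]
    · congr 1
      refine Finset.sum_congr rfl fun j hj => ?_
      rw [Nat.add_sub_cancel, sqrt_pi_mul_polarCoeff _ _ (by simp at hj; omega)]; ring
    -- Only `i = 2κ + 1` occurs below, where `(4κ + 1 - 2i)!` is the factorial of `-1`.
    · intro i _ hi
      rw [weight_eq_zero (by simpa using hi), zero_mul]
    · intro i hi hi'
      simp at hi hi'; omega
  have h2 : ∀ ν ∈ Finset.Icc (κ + 1) (2 * κ),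
      (coeffC (4 * κ + 1) (4 * κ + 2 - 2 * ν) ν / intFact ν +
          ∑ i ∈ Finset.Icc (4 * κ + 3 - 2 * ν) (2 * κ),
            (-1 / 4) ^ i / (intFact i * intFact (4 * (κ : ℤ) + 1 - 2 * i)) *
              (Complex.Gamma (4 * (κ : ℂ) + 3 / 2 - ν - i) /
                Complex.Gamma ((ν : ℂ) + 3 / 2))) *
          (z / 2) ^ (2 * ν - 2) =
        -Real.pi * (struveCoeff κ (ν - 1) * ((z / 2) ^ 2) ^ (ν - 1)) := by
    intro ν hν
    obtain ⟨N, rfl⟩ : ∃ N, ν = N + 1 := ⟨ν - 1, by simp at hν; omega⟩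
    have hN : κ ≤ N ∧ N + 1 ≤ 2 * κ := by simp at hν; omega
    rw [coeffC_div _ _ _ (by omega), struveCoeff, range_succ_eq_Icc,
      ← sum_Icc_add_sum_Icc (a := 0) (c := 2 * κ) _ (b := 4 * κ + 2 - 2 * (N + 1)) (by omega)
        (by omega),
      show 4 * κ + 3 - 2 * (N + 1) = 4 * κ + 2 - 2 * (N + 1) + 1 by omega, ← pow_mul,
      ← mul_assoc (-(Real.pi : ℂ)), mul_add (-(Real.pi : ℂ)), Finset.mul_sum, Finset.mul_sum]
    congr 2
    -- For `j ≤ 4κ + 2 - 2ν` the closed form `polarCoeff` is used, for larger `j` the Gamma quotient.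
    · refine Finset.sum_congr rfl fun j hj => ?_
      rw [Nat.add_sub_cancel, sqrt_pi_mul_polarCoeff _ _ (by simp at hj; omega)]; ring
    · refine Finset.sum_congr rfl fun j hj => ?_
      have hj' : j ≤ 4 * κ + 1 := by simp at hj; omega
      rw [Nat.add_sub_cancel, reducedCoeff_eq_derivCoeff _ _ (by simp at hj; omega),
        derivCoeff_eq_Gamma, weight, Nat.cast_sub hj']
      push_cast
      rw [show (N : ℂ) + 1 + 3 / 2 = N + 5 / 2 by ring,
        show 4 * (κ : ℂ) + 1 - j - N - 1 / 2 = 4 * κ + 3 / 2 - (N + 1) - j by ring]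
      field_simp
  rw [sigma2, hf, Finset.sum_congr rfl h1, Finset.sum_congr rfl h2,
    sum_Icc_add_sum_Icc _ (by omega) (by omega), ← Finset.mul_sum]
  have h3 : ∑ ν ∈ Finset.Icc 1 (2 * κ), struveCoeff κ (ν - 1) * ((z / 2) ^ 2) ^ (ν - 1) =
      ∑ N ∈ Finset.range (2 * κ), struveCoeff κ N * ((z / 2) ^ 2) ^ N := by
    refine Finset.sum_bij' (fun ν _ => ν - 1) (fun N _ => N + 1) ?_ ?_ ?_ ?_ ?_ <;>
      (intros; simp_all <;> omega)
  rw [h3]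
  field_simp

/-- The bracket of the `κ`-th term is the power series of the Struve part with its first `2κ`
coefficients, the ones of negative powers of `z`, deleted. -/
lemma hasSum_bracket (κ : ℕ) {z : ℂ} (hz : z ≠ 0) :
    HasSum (fun M => (4 * κ + 1).factorial / 2 * struveCoeff κ (M + 2 * κ) * (z / 2) ^ (2 * M))
      (struveH 0 z * sigma0 κ z * (2 / z) ^ (4 * κ + 1) +
        struveH 1 z * sigma1 κ z * (2 / z) ^ (4 * κ + 2) + sigma2 κ z * (2 / z) ^ (4 * κ)) := by
  have h1 := hasSum_of_eq (f := fun N => struveCoeff κ N * ((z / 2) ^ 2) ^ N)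
    (hasSum_sum (s := Finset.range (2 * κ + 1)) fun j _ =>
      (hasSum_reducedCoeff (4 * κ + 1 - j) (2 * κ + 1) (by omega) ((z / 2) ^ 2)).mul_left
        (weight κ j)) fun N => by
    rw [struveCoeff, Finset.sum_mul]
    exact Finset.sum_congr rfl fun j _ => mul_assoc _ _ _
  have h2 := ((hasSum_nat_add_iff' (2 * κ)).mpr h1).mul_left
    ((4 * κ + 1).factorial / 2 * (2 / z) ^ (4 * κ) : ℂ)
  have hu : z / 2 * (2 / z) = 1 := by field_simp
  have hX : ∀ f : ℕ → ℂ, ∀ A : ℂ, ∑ j ∈ Finset.range (2 * κ + 1), weight κ j * (f j * A) =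
      (∑ j ∈ Finset.range (2 * κ + 1), weight κ j * f j) * A := fun f A => by
    rw [Finset.sum_mul]; exact Finset.sum_congr rfl fun j _ => (mul_assoc _ _ _).symm
  simp only [mul_add (weight κ _), Finset.sum_add_distrib, hX] at h2
  have hv : struveH 0 z * sigma0 κ z * (2 / z) ^ (4 * κ + 1) +
      struveH 1 z * sigma1 κ z * (2 / z) ^ (4 * κ + 2) + sigma2 κ z * (2 / z) ^ (4 * κ) =
      (4 * κ + 1).factorial / 2 * (2 / z) ^ (4 * κ) *
        ((∑ j ∈ Finset.range (2 * κ + 1), weight κ j *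
          ∑ ν ∈ Finset.range (2 * κ + 1), lommelZero (4 * κ + 1 - j) ν * ((z / 2) ^ 2) ^ ν) *
            (∑' m, struveCoeffZero m * ((z / 2) ^ 2) ^ m) +
        (∑ j ∈ Finset.range (2 * κ + 1), weight κ j *
          ∑ ν ∈ Finset.range (2 * κ + 1), lommelOne (4 * κ + 1 - j) ν * ((z / 2) ^ 2) ^ ν) *
            (∑' m, struveCoeffOne m * ((z / 2) ^ 2) ^ m) -
        ∑ N ∈ Finset.range (2 * κ), struveCoeff κ N * ((z / 2) ^ 2) ^ N) := by
    rw [struveH_zero, struveH_one, sigma0_eq, sigma1_eq, sigma2_eq]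
    generalize (∑' m, struveCoeffZero m * ((z / 2) ^ 2) ^ m) = A
    generalize (∑' m, struveCoeffOne m * ((z / 2) ^ 2) ^ m) = B
    have hu2 : (2 / z) ^ (4 * κ + 1) = (2 / z) ^ (4 * κ) * (2 / z) := pow_succ _ _
    have hu3 : (2 / z) ^ (4 * κ + 2) = (2 / z) ^ (4 * κ) * (2 / z) ^ 2 := pow_add _ _ _
    have hu4 : (z / 2) ^ 2 * (2 / z) ^ 2 = 1 := by rw [← mul_pow, hu, one_pow]
    rw [hu2, hu3]
    generalize ∑ j ∈ Finset.range (2 * κ + 1), weight κ j *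
      ∑ ν ∈ Finset.range (2 * κ + 1), lommelZero (4 * κ + 1 - j) ν * ((z / 2) ^ 2) ^ ν = X
    generalize ∑ j ∈ Finset.range (2 * κ + 1), weight κ j *
      ∑ ν ∈ Finset.range (2 * κ + 1), lommelOne (4 * κ + 1 - j) ν * ((z / 2) ^ 2) ^ ν = Y
    linear_combination (A * ((4 * κ + 1).factorial / 2) * X * (2 / z) ^ (4 * κ)) * hu +
      (B * ((4 * κ + 1).factorial / 2) * Y * (2 / z) ^ (4 * κ)) * hu4
  rw [hv]
  refine hasSum_of_eq h2 fun M => ?_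
  have : ((2 / z) ^ (4 * κ) : ℂ) * ((z / 2) ^ 2) ^ (M + 2 * κ) = (z / 2) ^ (2 * M) := by
    rw [← pow_mul, mul_add, pow_add, show 2 * (2 * κ) = 4 * κ by ring, mul_left_comm, ← mul_pow,
      mul_comm (2 / z), hu, one_pow, mul_one]
  rw [← this]; ring

/-! ### Higher derivatives as polynomials in `z⁻¹ d/dz` -/

/-- The coefficient `k! / (2^j j! (k - 2j)!)` of `z^{k-2j} (z⁻¹ d/dz)^{k-j}` in `(d/dz)^k`. -/
def hermiteCoeff (k j : ℕ) : ℂ :=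
  k.factorial * (2 ^ j * (j.factorial : ℂ))⁻¹ * (intFact ((k : ℤ) - 2 * j))⁻¹

lemma hermiteCoeff_zero_right (k : ℕ) : hermiteCoeff k 0 = 1 := by
  have h : (k.factorial : ℂ) ≠ 0 := Nat.cast_ne_zero.mpr k.factorial_ne_zero
  simp [hermiteCoeff, intFact_natCast, h]

lemma hermiteCoeff_eq_zero {k j : ℕ} (h : k < 2 * j) : hermiteCoeff k j = 0 := by
  rw [hermiteCoeff, intFact_of_neg (by omega)]; simp

lemma hermiteCoeff_rec (k j : ℕ) : hermiteCoeff (k + 1) (j + 1) =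
    hermiteCoeff k (j + 1) + (k - 2 * j) * hermiteCoeff k j := by
  have h1 := inv_intFact ((k : ℤ) - 2 * j - 1)
  have h2 := inv_intFact ((k : ℤ) - 2 * j - 2)
  rw [sub_add_cancel] at h1
  rw [show (k : ℤ) - 2 * j - 2 + 1 = (k : ℤ) - 2 * j - 1 by ring, h1] at h2
  have hj : (j : ℂ) + 1 ≠ 0 := Nat.cast_add_one_ne_zero j
  have hf : (j.factorial : ℂ) ≠ 0 := Nat.cast_ne_zero.mpr j.factorial_ne_zero
  unfold hermiteCoeff
  rw [show ((k + 1 : ℕ) : ℤ) - 2 * (j + 1 : ℕ) = (k : ℤ) - 2 * j - 1 by push_cast; ring,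
    show (k : ℤ) - 2 * (j + 1 : ℕ) = (k : ℤ) - 2 * j - 2 by push_cast; ring, h2, h1]
  simp only [Nat.factorial_succ, pow_succ]
  push_cast
  field_simp
  ring

/-- The identity `(d/dz)^k = ∑_j k! / (2^j j! (k-2j)!) z^{k-2j} (z⁻¹ d/dz)^{k-j}`, evaluated at
`z^s`. -/
lemma sum_hermiteCoeff (k : ℕ) (s : ℂ) :
    ∑ j ∈ Finset.range (k + 1), hermiteCoeff k j * ∏ i ∈ Finset.range (k - j), (s - 2 * i) =
      ∏ i ∈ Finset.range k, (s - i) := by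
  induction k with
  | zero => simp [hermiteCoeff_zero_right]
  | succ k ih =>
    have e := Finset.sum_range_succ'
      (fun j => hermiteCoeff k j * ∏ i ∈ Finset.range (k + 1 - j), (s - 2 * i)) (k + 1)
    rw [Finset.sum_range_succ, hermiteCoeff_eq_zero (k := k) (j := k + 1) (by omega), zero_mul,
      add_zero] at e
    simp only [Nat.add_sub_add_right] at e
    rw [Finset.sum_range_succ']
    simp only [hermiteCoeff_rec, Nat.add_sub_add_right, add_mul, Finset.sum_add_distrib,
      hermiteCoeff_zero_right] at e ⊢
    rw [add_right_comm, ← e, ← Finset.sum_add_distrib, Finset.prod_range_succ, ← ih,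
      Finset.sum_mul]
    refine Finset.sum_congr rfl fun j hj => ?_
    have hj' : j ≤ k := by simp at hj; omega
    rw [Nat.succ_sub hj', Finset.prod_range_succ, Nat.cast_sub hj']
    ring

lemma prod_sub_mul_factorial (a k : ℕ) :
    (∏ i ∈ Finset.range k, ((a : ℂ) + k - i)) * a.factorial = (a + k).factorial := by
  induction k with
  | zero => simp
  | succ k ih =>
    rw [Finset.prod_range_succ', ← add_assoc, Nat.factorial_succ]
    push_cast
    rw [← ih, Finset.prod_congr rfl fun (i : ℕ) _ =>
      show (a : ℂ) + (k + 1) - ((i : ℂ) + 1) = a + k - i by ring]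
    ring

lemma inv_Gamma_sub_nat (N n : ℕ) : (Complex.Gamma ((N : ℂ) + 3 / 2 - n))⁻¹ =
    (∏ i ∈ Finset.range n, ((2 * N + 1 : ℂ) - 2 * i)) / 2 ^ n *
      (Complex.Gamma ((N : ℂ) + 3 / 2))⁻¹ := by
  induction n with
  | zero => simp
  | succ n ih =>
    have h := inv_Gamma ((N : ℂ) + 1 / 2 - n)
    rw [show (N : ℂ) + 1 / 2 - n + 1 = N + 3 / 2 - n by ring, ih] at h
    rw [show (N : ℂ) + 3 / 2 - (n + 1 : ℕ) = N + 1 / 2 - n by push_cast; ring, h,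
      Finset.prod_range_succ, pow_succ]
    field_simp

lemma inv_Gamma_half_int (N : ℕ) : ((2 * N + 1).factorial : ℂ) *
    (Complex.Gamma ((N : ℂ) + 3 / 2))⁻¹ = 2 ^ (2 * N + 1) * N.factorial * (√Real.pi : ℂ)⁻¹ := by
  induction N with
  | zero =>
    have h1 := inv_Gamma (1 / 2)
    rw [Gamma_half, show (1 / 2 : ℂ) + 1 = 3 / 2 by norm_num] at h1
    simp [h1]
  | succ N ih =>
    have h := inv_Gamma ((N : ℂ) + 3 / 2)
    rw [h] at ih
    rw [show ((N + 1 : ℕ) : ℂ) + 3 / 2 = N + 3 / 2 + 1 by push_cast; ring,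
      show 2 * (N + 1) + 1 = 2 * N + 1 + 1 + 1 by ring, pow_succ, pow_succ]
    simp only [Nat.factorial_succ] at ih ⊢
    push_cast at ih ⊢
    linear_combination 4 * (N + 1) * ih

/-! ### Wallis integrals and expansions under the integral sign -/

lemma integral_cos_pow_odd (N : ℕ) : ∫ θ in (0 : ℝ)..(Real.pi / 2), Real.cos θ ^ (2 * N + 1) =
    √Real.pi * N.factorial / (2 * Real.Gamma (N + 3 / 2)) := by
  induction N with
  | zero =>
    have h : Real.Gamma (3 / 2) = 1 / 2 * √Real.pi := by
      rw [show (3 / 2 : ℝ) = 1 / 2 + 1 by norm_num, Real.Gamma_add_one (by norm_num),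
        Real.Gamma_one_half_eq]
    have h' : √Real.pi ≠ 0 := Real.sqrt_ne_zero'.mpr Real.pi_pos
    simp [h]
    field_simp
  | succ N ih =>
    have hN : (N : ℝ) + 3 / 2 ≠ 0 := by positivity
    have hG : Real.Gamma (N + 3 / 2) ≠ 0 := (Real.Gamma_pos_of_pos (by positivity)).ne'
    rw [show 2 * (N + 1) + 1 = 2 * N + 1 + 2 by ring, integral_cos_pow, ih,
      show ((N + 1 : ℕ) : ℝ) + 3 / 2 = N + 3 / 2 + 1 by push_cast; ring, Real.Gamma_add_one hN,
      Nat.factorial_succ]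
    simp
    field_simp
    ring

lemma integral_cos_pow_odd_mul_sin_sq (N : ℕ) :
    ∫ θ in (0 : ℝ)..(Real.pi / 2), (Real.cos θ : ℂ) ^ (2 * N + 1) * (Real.sin θ : ℂ) ^ 2 =
      (√Real.pi : ℂ) / 4 * N.factorial * (Complex.Gamma ((N : ℂ) + 5 / 2))⁻¹ := by
  have hN : (N : ℝ) + 3 / 2 ≠ 0 := by positivity
  have hG : Real.Gamma (N + 3 / 2) ≠ 0 := (Real.Gamma_pos_of_pos (by positivity)).ne'
  have h : ∫ θ in (0 : ℝ)..(Real.pi / 2), Real.cos θ ^ (2 * N + 1) * Real.sin θ ^ 2 =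
      √Real.pi / 4 * N.factorial * (Real.Gamma ((N : ℝ) + 5 / 2))⁻¹ := by
    have e : ∀ θ : ℝ, Real.cos θ ^ (2 * N + 1) * Real.sin θ ^ 2 =
        Real.cos θ ^ (2 * N + 1) - Real.cos θ ^ (2 * (N + 1) + 1) := fun θ => by
      rw [Real.sin_sq]; ring
    simp only [e]
    rw [intervalIntegral.integral_sub (Continuous.intervalIntegrable (by fun_prop) _ _)
        (Continuous.intervalIntegrable (by fun_prop) _ _),
      integral_cos_pow_odd, integral_cos_pow_odd,
      show ((N + 1 : ℕ) : ℝ) + 3 / 2 = N + 3 / 2 + 1 by push_cast; ring,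
      show (N : ℝ) + 5 / 2 = N + 3 / 2 + 1 by ring, Real.Gamma_add_one hN, Nat.factorial_succ]
    push_cast
    field_simp
    ring
  rw [show (N : ℂ) + 5 / 2 = ((N + 5 / 2 : ℝ) : ℂ) by push_cast; ring, Complex.Gamma_ofReal]
  have h' := congrArg (fun x : ℝ => (x : ℂ)) h
  simp only [← intervalIntegral.integral_ofReal] at h'
  push_cast at h' ⊢
  exact h'

/-- Termwise integration of the cosine series against a continuous function. -/
lemma hasSum_integral_mul_cos {g : ℝ → ℂ} (hg : Continuous g) (c : ℂ) (p : ℕ) (a b : ℝ) :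
    HasSum (fun m : ℕ => (-1) ^ m * c ^ (2 * m) / (2 * m).factorial *
        ∫ θ in a..b, g θ * (Real.cos θ : ℂ) ^ (p * (2 * m)))
      (∫ θ in a..b, g θ * Complex.cos (c * (Real.cos θ : ℂ) ^ p)) := by
  have hs : Summable fun m : ℕ => ‖c‖ ^ (2 * m) / (2 * m).factorial :=
    (Real.summable_pow_div_factorial ‖c‖).comp_injective
      (i := fun m : ℕ => 2 * m) fun m n h => by simpa using h
  have key := intervalIntegral.hasSum_integral_of_dominated_convergence
    (μ := MeasureTheory.volume) (a := a) (b := b)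
    (F := fun (m : ℕ) θ => (-1) ^ m * c ^ (2 * m) / (2 * m).factorial *
      (g θ * (Real.cos θ : ℂ) ^ (p * (2 * m))))
    (f := fun θ => g θ * Complex.cos (c * (Real.cos θ : ℂ) ^ p))
    (fun m θ => ‖c‖ ^ (2 * m) / (2 * m).factorial * ‖g θ‖) ?_ ?_ ?_ ?_ ?_
  · simpa only [intervalIntegral.integral_const_mul] using key
  · intro m
    exact Continuous.aestronglyMeasurable (by fun_prop)
  · intro m
    refine Filter.Eventually.of_forall fun θ _ => ?_
    have hc : ‖(Real.cos θ : ℂ)‖ ≤ 1 := by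
      rw [Complex.norm_real]; exact Real.abs_cos_le_one θ
    rw [norm_mul, norm_mul, norm_div, norm_mul, norm_pow, norm_pow, norm_pow, norm_neg, norm_one,
      one_pow, one_mul, Complex.norm_natCast]
    gcongr
    exact mul_le_of_le_one_right (norm_nonneg _) (pow_le_one₀ (norm_nonneg _) hc)
  · exact Filter.Eventually.of_forall fun θ _ => hs.mul_right _
  · simp only [tsum_mul_right]
    exact Continuous.intervalIntegrable (by fun_prop) _ _
  · refine Filter.Eventually.of_forall fun θ _ => ?_
    have := (Complex.hasSum_cos (c * (Real.cos θ : ℂ) ^ p)).mul_left (g θ)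
    refine hasSum_of_eq this fun m => ?_
    rw [mul_pow, ← pow_mul]
    ring

/-! ### The series of the integral -/

/-- The coefficients that survive the subtraction of `σ₂` are those of the power series of the
integral: there `reducedCoeff` is `derivCoeff`, so that `sum_hermiteCoeff` sums over `j`. -/
lemma struveCoeff_add (κ M : ℕ) : (4 * κ + 1).factorial / 2 * struveCoeff κ (M + 2 * κ) =
    -(2 / Real.pi) * (-1) ^ M * 4 ^ M / (2 * M).factorial *
      ((√Real.pi : ℂ) / 4 * (M + 2 * κ).factorial *
        (Complex.Gamma (((M + 2 * κ : ℕ) : ℂ) + 5 / 2))⁻¹) := by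
  have hpi : (√Real.pi : ℂ) ≠ 0 :=
    Complex.ofReal_ne_zero.mpr (Real.sqrt_ne_zero'.mpr Real.pi_pos)
  have hpi2 : (Real.pi : ℂ) = √Real.pi * √Real.pi := by
    rw [← Complex.ofReal_mul, Real.mul_self_sqrt Real.pi_pos.le]
  have hM : ((2 * M).factorial : ℂ) ≠ 0 := Nat.cast_ne_zero.mpr (Nat.factorial_ne_zero _)
  set N := M + 2 * κ with hN
  set G := (Complex.Gamma ((N : ℂ) + 5 / 2))⁻¹ with hG
  set H := (Complex.Gamma ((N : ℂ) + 3 / 2))⁻¹ with hH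
  -- The sum over `j` is the expansion of the derivative of order `4κ + 1` of `z^{2N+1}`.
  have h1 : (4 * κ + 1).factorial * struveCoeff κ N = (-1) ^ (M + 1) / 2 ^ (4 * κ + 1) * H * G *
      ∏ i ∈ Finset.range (4 * κ + 1), ((2 * N + 1 : ℂ) - i) := by
    rw [← sum_hermiteCoeff, struveCoeff, Finset.mul_sum, Finset.mul_sum,
      sum_eq_sum_of_eq_zero (Finset.range (4 * κ + 1 + 1)) (Finset.range (2 * κ + 1))]
    · refine Finset.sum_congr rfl fun j hj => ?_
      have hj' : j ≤ 2 * κ := by simp at hj; omega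
      obtain ⟨n, hn⟩ := Nat.exists_eq_add_of_le (show j ≤ 4 * κ + 1 by omega)
      rw [reducedCoeff_eq_derivCoeff _ _ (by omega), derivCoeff, inv_Gamma_sub_nat, weight,
        hermiteCoeff, intFact_natCast,
        show 4 * (κ : ℤ) + 1 = ((4 * κ + 1 : ℕ) : ℤ) by push_cast; ring, ← hH, ← hG, hn, Nat.add_sub_cancel_left]
      have hs : ((-1) ^ (N + n) : ℂ) * (-1) ^ j = (-1) ^ (M + 1) := by
        rw [← pow_add, show N + n + j = M + 1 + 2 * (3 * κ) by omega, pow_add _ (M + 1),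
          pow_mul _ 2, neg_one_sq, one_pow, mul_one]
      rw [← hs, neg_div, neg_pow (1 / 4 : ℂ) j, pow_add 2 j n, one_div, inv_pow,
        show (4 : ℂ) = 2 * 2 by norm_num, mul_pow]
      simp only [div_eq_mul_inv, mul_inv]
      ring_nf
    · intro j _ hj
      rw [hermiteCoeff_eq_zero (by simp at hj; omega)]; simp
    · intro j hj hj'
      simp at hj hj'; omega
  -- As `2N + 1 = 2M + (4κ + 1)`, the falling factorial is `(2N + 1)! / (2M)!`.
  have h2 := prod_sub_mul_factorial (2 * M) (4 * κ + 1)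
  rw [show 2 * M + (4 * κ + 1) = 2 * N + 1 by omega, Finset.prod_congr rfl fun (i : ℕ) _ =>
    show ((2 * M : ℕ) : ℂ) + (4 * κ + 1 : ℕ) - (i : ℂ) = (2 * N + 1 : ℂ) - i by
      rw [hN]; push_cast; ring] at h2
  have h3 := inv_Gamma_half_int N
  rw [← hH, ← h2] at h3
  have h4 : (2 : ℂ) ^ (2 * N + 1) = 4 ^ M * 2 ^ (4 * κ + 1) := by
    rw [show (4 : ℂ) = 2 ^ 2 by norm_num, ← pow_mul, ← pow_add]; congr 1; omega
  rw [h4] at h3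
  have h5 : (∏ i ∈ Finset.range (4 * κ + 1), ((2 * N + 1 : ℂ) - i)) * H =
      4 ^ M * 2 ^ (4 * κ + 1) * N.factorial * (√Real.pi : ℂ)⁻¹ / (2 * M).factorial := by
    rw [eq_div_iff hM, ← h3]; ring
  rw [div_mul_eq_mul_div, h1, mul_right_comm, mul_assoc _ H, mul_comm H, mul_right_comm, h5, hpi2]
  field_simp
  ring

/-- The bracket of the `κ`-th term is a moment integral, by comparison of power series in `z`. -/
lemma bracket_eq_integral (κ : ℕ) {z : ℂ} (hz : z ≠ 0) :
    struveH 0 z * sigma0 κ z * (2 / z) ^ (4 * κ + 1) +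
        struveH 1 z * sigma1 κ z * (2 / z) ^ (4 * κ + 2) + sigma2 κ z * (2 / z) ^ (4 * κ) =
      -(2 / Real.pi) * ∫ θ in (0 : ℝ)..(Real.pi / 2),
        (Real.cos θ : ℂ) ^ (4 * κ + 1) * (Real.sin θ : ℂ) ^ 2 *
          Complex.cos (z * (Real.cos θ : ℂ)) := by
  have h := (hasSum_integral_mul_cos
    (g := fun θ => (Real.cos θ : ℂ) ^ (4 * κ + 1) * (Real.sin θ : ℂ) ^ 2) (by fun_prop) z 1 0
      (Real.pi / 2)).mul_left (-(2 / Real.pi) : ℂ)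
  simp only [pow_one, one_mul] at h
  refine (hasSum_bracket κ hz).unique (hasSum_of_eq h fun M => ?_)
  have e : ∀ θ : ℝ, (Real.cos θ : ℂ) ^ (4 * κ + 1) * (Real.sin θ : ℂ) ^ 2 *
      (Real.cos θ : ℂ) ^ (2 * M) =
        (Real.cos θ : ℂ) ^ (2 * (M + 2 * κ) + 1) * (Real.sin θ : ℂ) ^ 2 := fun θ => by ring
  simp only [e]
  rw [integral_cos_pow_odd_mul_sin_sq, struveCoeff_add, div_pow, pow_mul 2 2 M,
    show (2 : ℂ) ^ 2 = 4 by norm_num]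
  have h4 : (4 : ℂ) ^ M ≠ 0 := pow_ne_zero _ (by norm_num)
  field_simp

lemma hasSum_seriesTerm {z : ℂ} (ζ : ℂ) (hz : z ≠ 0) :
    HasSum (fun κ => (Real.pi : ℂ) / 2 * seriesTerm z ζ κ) (cosineIntegral z ζ) := by
  have hpi : (Real.pi : ℂ) ≠ 0 := Complex.ofReal_ne_zero.mpr Real.pi_ne_zero
  have h := hasSum_integral_mul_cos
    (g := fun θ => (Real.cos θ : ℂ) * (Real.sin θ : ℂ) ^ 2 * Complex.cos (z * (Real.cos θ : ℂ)))
    (by fun_prop) ζ 2 0 (Real.pi / 2)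
  refine hasSum_of_eq h fun κ => ?_
  have e : ∀ θ : ℝ, (Real.cos θ : ℂ) * (Real.sin θ : ℂ) ^ 2 * Complex.cos (z * (Real.cos θ : ℂ)) *
      (Real.cos θ : ℂ) ^ (2 * (2 * κ)) = (Real.cos θ : ℂ) ^ (4 * κ + 1) * (Real.sin θ : ℂ) ^ 2 *
        Complex.cos (z * (Real.cos θ : ℂ)) := fun θ => by ring
  simp only [e]
  rw [seriesTerm, bracket_eq_integral κ hz, intFact_of_eq (n := 2 * κ) (by push_cast; ring),
    pow_succ]
  field_simp

end StruveIntegral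

end

theorem mainTheorem5 (z ζ : ℂ) (hz : z ≠ 0) :
    Summable (StruveIntegral.seriesTerm z ζ) ∧
      StruveIntegral.cosineIntegral z ζ =
        (Real.pi : ℂ) / 2 * ∑' κ : ℕ, StruveIntegral.seriesTerm z ζ κ := by
  have h := StruveIntegral.hasSum_seriesTerm ζ hz
  have hpi : (Real.pi : ℂ) / 2 ≠ 0 :=
    div_ne_zero (Complex.ofReal_ne_zero.mpr Real.pi_ne_zero) two_ne_zero
  exact ⟨(summable_mul_left_iff hpi).mp h.summable, by rw [← tsum_mul_left, h.tsum_eq]⟩
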